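/- Let $L_n$ be the Legendre polynomials and $P_n(\omega)=\sqrt{2n+1}\,L_n(\omega/\pi)$, so that $\frac1{2\pi}\int_{-\pi}^{\pi}P_nP_m\,d\omega=\delta_{nm}$. Let $K^n=(-i)^nP_n\!\left(i\,\frac{d}{dz}\right)$ be the associated chromatic derivatives ($\omega^k$ in $P_n(\omega)$ is replaced by $i^k\,d^k/dz^k$), and write $K^n_u$ when the differentiation is with respect to $u$. Let $\operatorname{sinc}(z)=\frac{\sin \pi z}{\pi z}$, $\operatorname{sinc}(0)=1$, and let $j_n$ be the spherical Bessel function of the first kind of order $n$ (an entire function). Let $BL(\pi)$ be the space of continuous functions $g:\mathbb R\to\mathbb C$ in $L^2(\mathbb R)$ whose Fourier transform $\widehat g(\omega)=\int g(t)e^{-i\omega t}\,dt$ (in the sense of Plancherel) vanishes almost everywhere outside $[-\pi,\pi]$, with the $L^2$ norm. For every entire function $f$ and all $z,u\in\mathbb C$, \begin{align*} f(z)&=\sum_{n=0}^{\infty}K^n[f](u)\,K^n_u[\operatorname{sinc}(z-u)]\\ &=\sum_{n=0}^{\infty}(-1)^n\,K^n[f](u)\,K^n[\operatorname{sinc}](z-u)\\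 &=\sum_{n=0}^{\infty}K^n[f](u)\,\sqrt{2n+1}\;j_n(\pi(z-u)), \end{align*} where all three series converge absolutely, and they are one and the same series: for all $n\ge 0$ and $z,u\in\mathbb C$, $$K^n_u[\operatorname{sinc}(z-u)]=(-1)^nK^n[\operatorname{sinc}](z-u)=\sqrt{2n+1}\;j_n(\pi(z-u)).$$ If moreover the restriction of $f$ to $\mathbb R$ belongs to $BL(\pi)$, then for every $u\in\mathbb C$ the series, as a series of functions of $z=t\in\mathbb R$, converges to $f$ uniformly on $\mathbb R$ and in $BL(\pi)$; that is, its partial sums belong to $BL(\pi)$ and converge to $f$ in $L^2(\mathbb R)$. -/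

import Mathlib

namespace Chromatic

/-- The Legendre polynomial `Lₙ`, by Rodrigues' formula `Lₙ = (1 / (2ⁿ n!)) Dⁿ (X² - 1)ⁿ`. -/
noncomputable def legendre (n : ℕ) : Polynomial ℝ :=
  Polynomial.C (1 / (2 ^ n * (n.factorial : ℝ))) *
    (Polynomial.derivative^[n] ((Polynomial.X ^ 2 - 1) ^ n))

/-- The Legendre polynomials rescaled to `[-π, π]` and normalized,
`Pₙ(ω) = √(2n+1) Lₙ(ω / π)`; they are orthonormal for the weight `1 / (2π)` on `[-π, π]`. -/
noncomputable def orthoLegendre (n : ℕ) : Polynomial ℝ :=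
  Polynomial.C (Real.sqrt (2 * n + 1)) *
    (legendre n).comp (Polynomial.C (1 / Real.pi) * Polynomial.X)

/-- The chromatic derivative `Kⁿ = (-i)ⁿ Pₙ(i d/dz)`: the power `ωᵏ` in `Pₙ(ω)` is replaced by
`iᵏ dᵏ/dzᵏ`. -/
noncomputable def chromaticDeriv (n : ℕ) (f : ℂ → ℂ) (z : ℂ) : ℂ :=
  (-Complex.I) ^ n *
    (orthoLegendre n).sum fun k a => (a : ℂ) * Complex.I ^ k * iteratedDeriv k f z

/-- The normalized cardinal sine `sinc z = sin (π z) / (π z)`, with `sinc 0 = 1`. -/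
noncomputable def sinc (z : ℂ) : ℂ :=
  if z = 0 then 1 else Complex.sin (Real.pi * z) / (Real.pi * z)

/-- The spherical Bessel function of the first kind of order `n`, an entire function, by its
everywhere convergent power series
`jₙ(z) = zⁿ ∑ₖ (-z²/2)ᵏ / (k! (2n+2k+1)!!)`. -/
noncomputable def sphericalBessel (n : ℕ) (z : ℂ) : ℂ :=
  z ^ n * ∑' k : ℕ, (-(z ^ 2) / 2) ^ k /
    ((k.factorial : ℂ) * ((2 * n + 2 * k + 1).doubleFactorial : ℂ))

open scoped FourierTransform in
/-- The space `BL(π)` of `π` band limited signals of finite energy: continuous `L²` functions on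
`ℝ` whose (Plancherel) Fourier transform vanishes almost everywhere outside `[-π, π]`. Mathlib's
`𝓕 g ξ` is the transform `∫ g(t) e^{-iωt} dt` at the angular frequency `ω = 2 π ξ`. -/
def BL : Set (ℝ → ℂ) :=
  {g | Continuous g ∧ ∃ h : MeasureTheory.MemLp g 2 MeasureTheory.volume,
    ∀ᵐ ξ : ℝ, Real.pi < |2 * Real.pi * ξ| →
      (𝓕 (h.toLp g) : MeasureTheory.Lp ℂ 2 (MeasureTheory.volume : MeasureTheory.Measure ℝ)) ξ = 0}

/-- The chromatic approximation of `f` centred at `u`: the sum of the first `N` terms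
`Kⁿ[f](u) √(2n+1) jₙ(π(z-u))` of the chromatic expansion. -/
noncomputable def chromaticApprox (f : ℂ → ℂ) (u : ℂ) (N : ℕ) (z : ℂ) : ℂ :=
  ∑ n ∈ Finset.range N,
    chromaticDeriv n f u * (Real.sqrt (2 * n + 1) * sphericalBessel n (Real.pi * (z - u)))

end Chromatic

/-!
For an entire function `f = ∑ bₖ (z - u)ᵏ` the chromatic expansion is a rearrangement of the Taylor
series. The coefficient of the `k`-th derivative in `Kⁿ` vanishes unless `n = k + 2m`, and then it
is, up to normalization, the coefficient of `jₙ` in Gegenbauer's expansion of the monomial `wᵏ` in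
spherical Bessel functions (`legendre_coeff_add_two_mul`, `hasSum_gegenbauer`). The latter holds
because, with the power series of the `jₙ` inserted, it collapses to `wᵏ`: the other coefficients
are alternating sums that telescope (`sum_range_gegenbauer`). All the double series involved are
dominated by products of exponential series with `∑ |bₖ| |w|ᵏ`, so that the order of summation may
be changed (`hasSum_chromatic_add`).

The three forms of the expansion agree because `sinc` is the inverse Fourier transform of the
indicator function of the band, which is `[-1/2, 1/2]` in Mathlib's normalization. There `Kⁿ` acts
as multiplication by `(-i)ⁿ Pₙ(-2πξ)` (`chromaticDeriv_bandTransform`), while the Fourier transform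
of `Lₙ` on `[-1, 1]` is `2 (-i)ⁿ jₙ` (`integral_legendre_mul_exp`, from Rodrigues' formula by
integration by parts).

If `f` is band limited, it is the inverse transform of a square integrable function `g` on the
band, also at complex arguments (`exists_eq_bandTransform`). The number `Kⁿ[f](u)` is then, up to a
power of `-i`, the coefficient of `g(ξ) e^{2πiξu}` with respect to `Pₙ(-2πξ)`, and the partial sums
of the chromatic expansion are the inverse transforms of the partial sums of this Legendre
expansion, multiplied by `e^{-2πiξu}` (`chromaticApprox_bandTransform`). The Legendre expansion
converges in `L²` by Bessel's inequality. The inverse transform is isometric and carries `L²`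
convergence on the band to uniform convergence on the line, and the limit is `f` by the pointwise
convergence already known.
-/

namespace Chromatic
open Nat Finset Filter Topology MeasureTheory
open scoped FourierTransform ContDiff SchwartzMap

/-! ### Double factorials and the coefficients of the Legendre polynomials -/

lemma doubleFactorial_odd_succ (N : ℕ) :
    (((2 * (N + 1) + 1)‼ : ℕ) : ℝ) = (2 * N + 3) * ((2 * N + 1)‼ : ℕ) := by
  rw [show 2 * (N + 1) + 1 = (2 * N + 1) + 2 by ring, Nat.doubleFactorial_add_two]
  push_cast; ring

/-- The relation `(2N)! (2N+1) = 2ᴺ N! (2N+1)!!`, which lets odd double factorials stand for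
`(2N-1)!!` without a truncated subtraction. -/
lemma factorial_two_mul (N : ℕ) :
    ((2 * N)! : ℝ) * (2 * N + 1) = 2 ^ N * N ! * ((2 * N + 1)‼ : ℕ) := by
  induction N with
  | zero => simp
  | succ N ih =>
    rw [doubleFactorial_odd_succ, Nat.factorial_succ N,
      show 2 * (N + 1) = 2 * N + 1 + 1 by ring, Nat.factorial_succ, Nat.factorial_succ]
    push_cast
    linear_combination (2 * (N : ℝ) + 3) * (2 * N + 2) * ih

/-- The coefficient of `j_{k+2m}` in the Gegenbauer expansion of the monomial `wᵏ` in spherical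
Bessel functions, `(2k+4m+1) (2k+2m-1)!! / (2ᵐ m!)`; the factor `(2k+2m-1)!!` is written
`(2k+2m+1)!! / (2k+2m+1)`. -/
noncomputable def gegenbauerCoeff (k m : ℕ) : ℝ :=
  (2 * k + 4 * m + 1) * ((2 * (k + m) + 1)‼ : ℕ) / ((2 * k + 2 * m + 1) * (2 ^ m * m !))

/-- With the power series of the spherical Bessel functions inserted in the Gegenbauer expansion of
`wᵏ`, the coefficient of `w^(k+2(s+1))` is, up to normalization, the sum on the left for
`M = s + 1`. It telescopes to `0`, since `s.choose (s + 1) = 0`. -/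
lemma sum_range_gegenbauer (k s M : ℕ) :
    ∑ m ∈ range (M + 1), (-1 : ℝ) ^ m * ((s + 1).choose m) *
      ((2 * k + 4 * m + 1) * ((2 * (k + m) + 1)‼ : ℕ) / (2 * k + 2 * m + 1) /
        ((2 * (k + m + (s + 1)) + 1)‼ : ℕ)) =
    (-1) ^ M * (s.choose M) * ((2 * (k + M) + 1)‼ : ℕ) / ((2 * (k + M + (s + 1)) + 1)‼ : ℕ) := by
  induction M with
  | zero =>
    have : (2 * (k : ℝ) + 1) ≠ 0 := by positivity
    simp
    field_simp
  | succ M ih =>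
    rw [sum_range_succ, ih, show k + (M + 1) = (k + M) + 1 by ring,
      show k + M + 1 + (s + 1) = (k + M + (s + 1)) + 1 by ring, doubleFactorial_odd_succ,
      doubleFactorial_odd_succ]
    have h1 : (((2 * (k + M) + 1)‼ : ℕ) : ℝ) ≠ 0 := by exact_mod_cast (doubleFactorial_pos _).ne'
    have h2 : (((2 * (k + M + (s + 1)) + 1)‼ : ℕ) : ℝ) ≠ 0 := by
      exact_mod_cast (doubleFactorial_pos _).ne'
    generalize (((2 * (k + M) + 1)‼ : ℕ) : ℝ) = d at *
    generalize (((2 * (k + M + (s + 1)) + 1)‼ : ℕ) : ℝ) = e at *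
    have h3 : ((M : ℝ) + 1) * (s + 1).choose (M + 1) = (s + 1) * s.choose M := by
      have := Nat.add_one_mul_choose_eq s M
      have h := congrArg (Nat.cast : ℕ → ℝ) this
      push_cast at h; linarith
    have h4 : ((s + 1).choose (M + 1) : ℝ) = s.choose M + s.choose (M + 1) := by
      rw [Nat.choose_succ_succ]; push_cast; ring
    have h5 : (2 * (k : ℝ) + 2 * M + 3) ≠ 0 := by positivity
    have h6 : (2 * ((k : ℝ) + M + (s + 1)) + 3) ≠ 0 := by positivity
    push_cast
    rw [h4] at h3 ⊢
    rw [show 2 * ((k : ℝ)) + 2 * (M + 1) + 1 = 2 * k + 2 * M + 3 by ring,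
      show 2 * ((k : ℝ) + M) + 3 = 2 * k + 2 * M + 3 by ring, pow_succ]
    field_simp
    linear_combination (-2) * h3

lemma legendre_coeff (n k : ℕ) :
    (legendre n).coeff k = 1 / (2 ^ n * n !) * ((k + n).descFactorial n *
      if 2 ∣ k + n then (-1) ^ (n - (k + n) / 2) * (n.choose ((k + n) / 2) : ℝ) else 0) := by
  have h : (Polynomial.X ^ 2 - 1 : Polynomial ℝ) ^ n =
      Polynomial.expand ℝ 2 ((Polynomial.X - Polynomial.C 1) ^ n) := by simp
  rw [legendre, Polynomial.coeff_C_mul, Polynomial.coeff_iterate_derivative, h,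
    Polynomial.coeff_expand (by norm_num), nsmul_eq_mul, sub_eq_add_neg, ← Polynomial.C_neg,
    Polynomial.coeff_X_add_C_pow]

/-- The coefficient vanishes beyond the degree and for the wrong parity. -/
lemma legendre_coeff_eq_zero {n k : ℕ} (h : ∀ m, n ≠ k + 2 * m) : (legendre n).coeff k = 0 := by
  rw [legendre_coeff]
  split_ifs with hd
  · rw [Nat.choose_eq_zero_of_lt]
    · simp
    · obtain ⟨c, hc⟩ := hd
      have := h (n - c)
      omega
  · simp

/-- The coefficients of the Legendre polynomials are, up to normalization, those of the Gegenbauer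
expansions of the monomials. -/
lemma legendre_coeff_add_two_mul (k m : ℕ) :
    (2 * (k + 2 * m : ℕ) + 1) * (legendre (k + 2 * m)).coeff k * k ! =
      (-1) ^ m * gegenbauerCoeff k m := by
  rw [legendre_coeff, if_pos (by omega), show k + (k + 2 * m) = 2 * (k + m) by ring,
    show k + 2 * m - 2 * (k + m) / 2 = m by omega, show 2 * (k + m) / 2 = k + m by omega,
    gegenbauerCoeff]
  have h1 : (k ! : ℝ) * (2 * (k + m)).descFactorial (k + 2 * m) = (2 * (k + m))! := by
    have := Nat.factorial_mul_descFactorial (n := 2 * (k + m)) (k := k + 2 * m) (by omega)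
    rw [show 2 * (k + m) - (k + 2 * m) = k by omega] at this
    exact_mod_cast this
  have h2 := factorial_two_mul (k + m)
  have h3 : ((k + 2 * m).choose (k + m) : ℝ) * (k + m)! * m ! = (k + 2 * m)! := by
    have := Nat.choose_mul_factorial_mul_factorial (n := k + 2 * m) (k := k + m) (by omega)
    rw [show k + 2 * m - (k + m) = m by omega] at this
    exact_mod_cast this
  have h4 : ((k + 2 * m).choose (k + m) : ℝ) = (k + 2 * m)! / ((k + m)! * m !) := by
    rw [eq_div_iff (by positivity), ← h3]; ring
  have h5 : ((2 * (k + m)).descFactorial (k + 2 * m) : ℝ) =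
      2 ^ (k + m) * (k + m)! * ((2 * (k + m) + 1)‼ : ℕ) / (2 * (k + m : ℕ) + 1) / k ! := by
    rw [eq_div_iff (by positivity), eq_div_iff (by positivity), ← h2, ← h1]; ring
  rw [h4, h5]
  have h6 : (2 * (k : ℝ) + 2 * m + 1) ≠ 0 := by positivity
  push_cast
  rw [show (2 : ℝ) ^ (k + 2 * m) = 2 ^ (k + m) * 2 ^ m by ring,
    show 2 * ((k : ℝ) + m) + 1 = 2 * k + 2 * m + 1 by ring]
  field_simp
  ring

/-! ### Gegenbauer's expansion of monomials in spherical Bessel functions -/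

lemma gegenbauerCoeff_nonneg (k m : ℕ) : 0 ≤ gegenbauerCoeff k m := by
  unfold gegenbauerCoeff; positivity

/-- The quotient `(2N+1)!! / (2N+1) = (2N-1)!!` is monotone in `N`, with denominators cleared. -/
lemma doubleFactorial_odd_mul_le (N i : ℕ) :
    (((2 * N + 1)‼ : ℕ) : ℝ) * (2 * (N + i) + 1) ≤ ((2 * (N + i) + 1)‼ : ℕ) * (2 * N + 1) := by
  induction i with
  | zero => simp
  | succ i ih =>
    rw [show N + (i + 1) = (N + i) + 1 by ring, doubleFactorial_odd_succ]
    push_cast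
    have h0 : (0 : ℝ) ≤ ((2 * N + 1)‼ : ℕ) := by positivity
    have h1 : (0 : ℝ) ≤ (2 * (N + i) + 3 : ℝ) * ((2 * N + 1)‼ : ℕ) * (2 * (N + i)) := by positivity
    have h2 := mul_le_mul_of_nonneg_left ih (show (0 : ℝ) ≤ 2 * (N + i) + 3 by positivity)
    linarith

/-- The growth of the Gegenbauer coefficients is compensated by the leading coefficient
`1 / (2n+1)!!` of `jₙ`, with a factor `1 / m!` to spare. -/
lemma gegenbauerCoeff_mul_factorial_le (k m : ℕ) :
    gegenbauerCoeff k m * m ! ≤ ((2 * (k + 2 * m) + 1)‼ : ℕ) := by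
  have h := doubleFactorial_odd_mul_le (k + m) m
  rw [show k + m + m = k + 2 * m by ring] at h
  have h2 : (1 : ℝ) ≤ 2 ^ m := one_le_pow₀ (by norm_num)
  have h3 : gegenbauerCoeff k m * m ! * 2 ^ m =
      (((2 * (k + m) + 1)‼ : ℕ) : ℝ) * (2 * (((k + m : ℕ) : ℝ) + m) + 1) /
        (2 * ((k + m : ℕ) : ℝ) + 1) := by
    unfold gegenbauerCoeff
    push_cast
    have h6 : (2 * (k : ℝ) + 2 * m + 1) ≠ 0 := by positivity
    rw [show 2 * ((k : ℝ) + m) + 1 = 2 * k + 2 * m + 1 by ring]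
    field_simp
    ring
  calc gegenbauerCoeff k m * m ! ≤ gegenbauerCoeff k m * m ! * 2 ^ m :=
        le_mul_of_one_le_right (mul_nonneg (gegenbauerCoeff_nonneg k m) (by positivity)) h2
    _ ≤ _ := by
        rw [h3, div_le_iff₀ (by positivity)]
        exact h

lemma doubleFactorial_odd_mono (N j : ℕ) : (2 * N + 1)‼ ≤ (2 * N + 2 * j + 1)‼ := by
  induction j with
  | zero => simp
  | succ j ih =>
    rw [show 2 * N + 2 * (j + 1) + 1 = (2 * N + 2 * j + 1) + 2 by ring, doubleFactorial_add_two]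
    nlinarith

/-- The `j`-th term of the power series of `j_n(w)`. -/
noncomputable def besselTerm (n : ℕ) (w : ℂ) (j : ℕ) : ℂ :=
  w ^ n * ((-(w ^ 2) / 2) ^ j / ((j ! : ℂ) * ((2 * n + 2 * j + 1)‼ : ℂ)))

lemma norm_besselTerm_le (n : ℕ) (w : ℂ) (j : ℕ) :
    ‖besselTerm n w j‖ ≤ ‖w‖ ^ n / ((2 * n + 1)‼ : ℕ) * ((‖w‖ ^ 2) ^ j / j !) := by
  have h : (((2 * n + 1)‼ : ℕ) : ℝ) ≤ ((2 * n + 2 * j + 1)‼ : ℕ) := by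
    exact_mod_cast doubleFactorial_odd_mono n j
  have h0 : (0 : ℝ) < ((2 * n + 1)‼ : ℕ) := by exact_mod_cast doubleFactorial_pos _
  have e : ‖besselTerm n w j‖ =
      ‖w‖ ^ n * ((‖w‖ ^ 2 / 2) ^ j / (j ! * ((2 * n + 2 * j + 1)‼ : ℕ))) := by
    simp [besselTerm]
  rw [e, _root_.div_mul_div_comm, ← mul_div_assoc, mul_comm (((2 * n + 1)‼ : ℕ) : ℝ)]
  gcongr
  linarith [sq_nonneg ‖w‖]

lemma hasSum_besselTerm (n : ℕ) (w : ℂ) :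
    HasSum (besselTerm n w) (sphericalBessel n w) := by
  have h : Summable (besselTerm n w) :=
    Summable.of_norm_bounded ((Real.summable_pow_div_factorial _).mul_left _)
      (norm_besselTerm_le n w)
  have := h.hasSum
  rwa [show ∑' j, besselTerm n w j = sphericalBessel n w from tsum_mul_left] at this

lemma sphericalBessel_neg (n : ℕ) (w : ℂ) :
    sphericalBessel n (-w) = (-1) ^ n * sphericalBessel n w := by
  unfold sphericalBessel
  rw [neg_pow w n, neg_sq, mul_assoc]

lemma norm_gegenbauerCoeff_mul_besselTerm_le (k m : ℕ) (w : ℂ) (j : ℕ) :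
    ‖(gegenbauerCoeff k m : ℂ) * besselTerm (k + 2 * m) w j‖ ≤
      ‖w‖ ^ k * (((‖w‖ ^ 2) ^ m / m !) * ((‖w‖ ^ 2) ^ j / j !)) := by
  rw [norm_mul, Complex.norm_real, Real.norm_of_nonneg (gegenbauerCoeff_nonneg k m)]
  have h0 : (0 : ℝ) < ((2 * (k + 2 * m) + 1)‼ : ℕ) := by exact_mod_cast doubleFactorial_pos _
  calc _ ≤ gegenbauerCoeff k m * (‖w‖ ^ (k + 2 * m) / ((2 * (k + 2 * m) + 1)‼ : ℕ) *
          ((‖w‖ ^ 2) ^ j / j !)) :=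
        mul_le_mul_of_nonneg_left (norm_besselTerm_le _ w j) (gegenbauerCoeff_nonneg k m)
    _ = ‖w‖ ^ k * ((gegenbauerCoeff k m * m ! / ((2 * (k + 2 * m) + 1)‼ : ℕ) *
          (‖w‖ ^ 2) ^ m / m !) * ((‖w‖ ^ 2) ^ j / j !)) := by
        rw [pow_add, pow_mul]
        field_simp
    _ ≤ _ := by
        gcongr
        apply mul_le_of_le_one_left (by positivity)
        rw [div_le_one h0]
        exact gegenbauerCoeff_mul_factorial_le k m

lemma norm_gegenbauerCoeff_mul_sphericalBessel_le (k m : ℕ) (w : ℂ) :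
    ‖(gegenbauerCoeff k m : ℂ) * sphericalBessel (k + 2 * m) w‖ ≤
      ‖w‖ ^ k * (((‖w‖ ^ 2) ^ m / m !) * Real.exp (‖w‖ ^ 2)) := by
  have h := (hasSum_besselTerm (k + 2 * m) w).mul_left (gegenbauerCoeff k m : ℂ)
  rw [← h.tsum_eq]
  have h2 : HasSum (fun j : ℕ => (‖w‖ ^ 2) ^ j / (j ! : ℝ)) (Real.exp (‖w‖ ^ 2)) := by
    rw [Real.exp_eq_exp_ℝ]
    exact NormedSpace.expSeries_div_hasSum_exp (‖w‖ ^ 2)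
  exact tsum_of_norm_bounded ((h2.mul_left _).mul_left _)
    (norm_gegenbauerCoeff_mul_besselTerm_le k m w)

/-- The coefficient of `w^(k+2(s+1))` in the Gegenbauer expansion of `wᵏ`, with the power series of
the spherical Bessel functions inserted, vanishes. -/
lemma sum_antidiagonal_gegenbauer (k : ℕ) (w : ℂ) (s : ℕ) :
    ∑ p ∈ antidiagonal (s + 1), (gegenbauerCoeff k p.1 : ℂ) * besselTerm (k + 2 * p.1) w p.2 = 0 := by
  rw [Finset.Nat.sum_antidiagonal_eq_sum_range_succ_mk]
  have key := sum_range_gegenbauer k s (s + 1)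
  rw [Nat.choose_succ_self] at key
  simp only [Nat.cast_zero, mul_zero, zero_mul, zero_div] at key
  have key' := congrArg (fun x : ℝ => (x : ℂ) * (w ^ (k + 2 * (s + 1)) * (-1 / 2) ^ (s + 1) /
    (s + 1)!)) key
  simp only [Complex.ofReal_zero, zero_mul, Complex.ofReal_sum, sum_mul] at key'
  rw [← key']
  refine sum_congr rfl fun m hm => ?_
  have hm' : m ≤ s + 1 := by simpa [Nat.lt_succ_iff] using hm
  obtain ⟨j, hj⟩ := Nat.exists_eq_add_of_le hm'
  rw [hj, Nat.add_sub_cancel_left]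
  have hc : ((m + j).choose m : ℝ) = (m + j)! / (m ! * j !) := Nat.cast_add_choose ℝ
  rw [hc, besselTerm, gegenbauerCoeff,
    show 2 * (k + 2 * m) + 2 * j + 1 = 2 * (k + m + (m + j)) + 1 by ring]
  have h6 : (2 * (k : ℂ) + 2 * m + 1) ≠ 0 := by
    have : ((2 * k + 2 * m + 1 : ℕ) : ℂ) ≠ 0 := Nat.cast_ne_zero.mpr (by omega)
    push_cast at this; exact this
  have h7 : (((2 * (k + m + (m + j)) + 1)‼ : ℕ) : ℂ) ≠ 0 :=
    Nat.cast_ne_zero.mpr (doubleFactorial_pos _).ne'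
  have h8 : ∀ i : ℕ, ((i ! : ℕ) : ℂ) ≠ 0 := fun i => Nat.cast_ne_zero.mpr (factorial_pos _).ne'
  have h8m := h8 m
  have h8j := h8 j
  have h8mj := h8 (m + j)
  push_cast
  rw [show (-(w ^ 2) / 2) ^ j = w ^ (2 * j) * (-1 / 2) ^ j by rw [pow_mul, ← mul_pow]; ring,
    show k + 2 * (m + j) = k + 2 * m + 2 * j by ring, pow_add w (k + 2 * m), pow_add (-1 / 2 : ℂ) m j,
    show (-1 / 2 : ℂ) ^ m = (-1) ^ m / 2 ^ m by rw [div_pow]]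
  rcases neg_one_pow_eq_or ℂ m with h9 | h9 <;> rw [h9] <;> field_simp

/-- Gegenbauer's expansion of a monomial in spherical Bessel functions. -/
lemma hasSum_gegenbauer (k : ℕ) (w : ℂ) :
    HasSum (fun m => (gegenbauerCoeff k m : ℂ) * sphericalBessel (k + 2 * m) w) (w ^ k) := by
  set T : ℕ × ℕ → ℂ := fun p => (gegenbauerCoeff k p.1 : ℂ) * besselTerm (k + 2 * p.1) w p.2
  have hx := Real.summable_pow_div_factorial (‖w‖ ^ 2)
  have hT : Summable T :=
    Summable.of_norm_bounded ((hx.mul_of_nonneg hx (fun _ => by positivity)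
      (fun _ => by positivity)).mul_left (‖w‖ ^ k))
      (fun p => norm_gegenbauerCoeff_mul_besselTerm_le k p.1 w p.2)
  have h1 : HasSum (fun m => (gegenbauerCoeff k m : ℂ) * sphericalBessel (k + 2 * m) w)
      (∑' p, T p) := hT.hasSum.prod_fiberwise fun m => (hasSum_besselTerm _ w).mul_left _
  -- collecting equal powers of `w` leaves only the power `wᵏ`
  have h2 : HasSum (fun s => ∑ p ∈ antidiagonal s, T p) (∑' p, T p) := by
    have := (Equiv.hasSum_iff Finset.HasAntidiagonal.sigmaAntidiagonalEquivProd (f := T)).mpr hT.hasSum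
    refine this.sigma fun s => ?_
    exact Finset.hasSum (antidiagonal s) T
  have h3 : HasSum (fun s => ∑ p ∈ antidiagonal s, T p) (w ^ k) := by
    have : w ^ k = ∑ p ∈ antidiagonal 0, T p := by
      have h6 : (2 * (k : ℂ) + 1) ≠ 0 := by exact_mod_cast (show 2 * k + 1 ≠ 0 by omega)
      have h7 : (((2 * k + 1)‼ : ℕ) : ℂ) ≠ 0 := Nat.cast_ne_zero.mpr (doubleFactorial_pos _).ne'
      simp [T, gegenbauerCoeff, besselTerm]
      field_simp
    rw [this]
    refine hasSum_single 0 fun s hs => ?_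
    obtain ⟨s, rfl⟩ := Nat.exists_eq_succ_of_ne_zero hs
    exact sum_antidiagonal_gegenbauer k w s
  rwa [h2.unique h3] at h1

/-! ### The chromatic expansion of an entire function -/

lemma orthoLegendre_coeff (n k : ℕ) : (orthoLegendre n).coeff k =
    √(2 * n + 1) * ((legendre n).coeff k * (1 / Real.pi) ^ k) := by
  rw [orthoLegendre, Polynomial.coeff_C_mul, Polynomial.comp_C_mul_X_coeff]

lemma orthoLegendre_coeff_of_lt {n k : ℕ} (h : n < k) : (orthoLegendre n).coeff k = 0 := by
  rw [orthoLegendre_coeff, legendre_coeff_eq_zero (by omega)]; simp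

lemma chromaticDeriv_eq_sum (n : ℕ) (f : ℂ → ℂ) (z : ℂ) :
    chromaticDeriv n f z = ∑ k ∈ range (n + 1), (-Complex.I) ^ n *
      (((orthoLegendre n).coeff k : ℂ) * Complex.I ^ k * iteratedDeriv k f z) := by
  rw [chromaticDeriv, Polynomial.sum_over_range' _ _ (n + 1), mul_sum]
  · rw [Nat.lt_succ_iff]
    exact Polynomial.natDegree_le_iff_coeff_eq_zero.mpr fun k hk => orthoLegendre_coeff_of_lt hk
  · simp

lemma sqrt_mul_orthoLegendre_coeff (k m : ℕ) :
    √(2 * (k + 2 * m : ℕ) + 1) * (orthoLegendre (k + 2 * m)).coeff k =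
      (-1) ^ m * gegenbauerCoeff k m / (k ! * Real.pi ^ k) := by
  have h : √(2 * (k + 2 * m : ℕ) + 1) * √(2 * (k + 2 * m : ℕ) + 1) =
      (2 * (k + 2 * m : ℕ) + 1 : ℝ) := Real.mul_self_sqrt (by positivity)
  rw [← legendre_coeff_add_two_mul, orthoLegendre_coeff, ← mul_assoc, h]
  have := Real.pi_pos
  rw [one_div, inv_pow]
  field_simp

/-- The chromatic expansion of an entire function. After expanding each chromatic derivative in
ordinary derivatives, the double series converges absolutely and summing it over the order of the
chromatic derivatives first gives the Taylor series, by `hasSum_gegenbauer`. -/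
theorem hasSum_chromatic_add {f : ℂ → ℂ} (hf : Differentiable ℂ f) (u w : ℂ) :
    HasSum (fun n : ℕ => chromaticDeriv n f u * (√(2 * n + 1) * sphericalBessel n (Real.pi * w)))
      (f (u + w)) := by
  set G : ℕ × ℕ → ℂ := fun p => (-Complex.I) ^ p.2 *
    (((orthoLegendre p.2).coeff p.1 : ℂ) * Complex.I ^ p.1 * iteratedDeriv p.1 f u) *
    (√(2 * p.2 + 1) * sphericalBessel p.2 (Real.pi * w)) with hG
  have hpi : (Real.pi : ℂ) ≠ 0 := Complex.ofReal_ne_zero.mpr Real.pi_ne_zero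
  have hk : ∀ k : ℕ, (k ! : ℂ) ≠ 0 := fun k => Nat.cast_ne_zero.mpr (factorial_pos k).ne'
  set b : ℕ → ℂ := fun k => iteratedDeriv k f u / (k ! : ℂ)
  have hb : ∀ v : ℂ, HasSum (fun k => b k * v ^ k) (f (u + v)) := fun v => by
    have := Complex.hasSum_taylorSeries_of_entire hf u (u + v)
    simp only [smul_eq_mul, add_sub_cancel_left] at this
    refine this.congr_fun fun k => ?_
    simp only [b]; field_simp
  have hG1 : ∀ k m, G (k, k + 2 * m) = b k / Real.pi ^ k *
      (gegenbauerCoeff k m * sphericalBessel (k + 2 * m) (Real.pi * w)) := fun k m => by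
    have h1 := congrArg (Complex.ofReal) (sqrt_mul_orthoLegendre_coeff k m)
    have h2 : (-Complex.I) ^ (k + 2 * m) * Complex.I ^ k = (-1) ^ m := by
      rw [pow_add, pow_mul, neg_sq, Complex.I_sq, mul_right_comm, ← mul_pow]
      simp
    have h3 : (-1 : ℂ) ^ m * (-1) ^ m = 1 := by rw [← mul_pow]; simp
    push_cast at h1
    simp only [hG, b]
    push_cast
    calc _ = ((-Complex.I) ^ (k + 2 * m) * Complex.I ^ k) *
        ((√(2 * (k + 2 * m) + 1) : ℂ) * (orthoLegendre (k + 2 * m)).coeff k) *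
          (iteratedDeriv k f u * sphericalBessel (k + 2 * m) (Real.pi * w)) := by ring
      _ = ((-1 : ℂ) ^ m * (-1) ^ m) * (gegenbauerCoeff k m / (k ! * Real.pi ^ k)) *
          (iteratedDeriv k f u * sphericalBessel (k + 2 * m) (Real.pi * w)) := by
        rw [h1, h2]; ring
      _ = _ := by rw [h3]; field_simp
  -- by parity the double family is supported on the pairs `(k, k + 2m)`
  set e : ℕ × ℕ → ℕ × ℕ := fun p => (p.1, p.1 + 2 * p.2)
  have he : Function.Injective e := by
    rintro ⟨a, b⟩ ⟨c, d⟩ h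
    simp only [e, Prod.mk.injEq] at h ⊢
    omega
  have he0 : ∀ p ∉ Set.range e, G p = 0 := by
    rintro ⟨k, n⟩ hp
    have : (orthoLegendre n).coeff k = 0 := by
      rw [orthoLegendre_coeff, legendre_coeff_eq_zero]
      · simp
      · exact fun m hm => hp ⟨(k, m), by simp [e, hm]⟩
    simp [hG, this]
  set x : ℝ := ‖(Real.pi * w : ℂ)‖ ^ 2
  have hs : Summable (G ∘ e) := by
    have h1 : Summable fun k => ‖b k‖ * ‖w‖ ^ k := by
      simpa using (hb w).summable.norm
    have h2 : Summable fun m : ℕ => x ^ m / m ! * Real.exp x :=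
      (Real.summable_pow_div_factorial x).mul_right _
    refine Summable.of_norm_bounded
      (h1.mul_of_nonneg h2 (fun _ => by positivity) (fun _ => by positivity)) fun p => ?_
    obtain ⟨k, m⟩ := p
    simp only [Function.comp, e, hG1]
    rw [norm_mul]
    refine (mul_le_mul_of_nonneg_left
      (norm_gegenbauerCoeff_mul_sphericalBessel_le k m (Real.pi * w)) (norm_nonneg _)).trans
      (le_of_eq ?_)
    rw [← mul_assoc]
    congr 1
    have := Real.pi_pos
    simp only [norm_div, norm_pow, norm_mul, Complex.norm_real, Real.norm_of_nonneg this.le]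
    rw [mul_pow]
    field_simp
  have hsum : HasSum (G ∘ e) (f (u + w)) := by
    have h1 : HasSum (fun k => b k * w ^ k) (∑' p, (G ∘ e) p) := by
      refine hs.hasSum.prod_fiberwise fun k => ?_
      have := (hasSum_gegenbauer k (Real.pi * w)).mul_left (b k / Real.pi ^ k)
      rw [mul_pow, ← mul_assoc, div_mul_cancel₀ _ (pow_ne_zero _ hpi)] at this
      exact this.congr_fun fun m => hG1 k m
    rw [← h1.unique (hb w)]
    exact hs.hasSum
  have hswap := (Equiv.hasSum_iff (Equiv.prodComm ℕ ℕ) (f := G)).mpr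
    ((he.hasSum_iff he0).mp hsum)
  refine hswap.prod_fiberwise fun n => ?_
  rw [chromaticDeriv_eq_sum, sum_mul]
  refine hasSum_sum_of_ne_finset_zero fun k hk => ?_
  have : (orthoLegendre n).coeff k = 0 := orthoLegendre_coeff_of_lt (by simpa using hk)
  simp [hG, this]

theorem hasSum_chromatic {f : ℂ → ℂ} (hf : Differentiable ℂ f) (z u : ℂ) :
    HasSum (fun n : ℕ => chromaticDeriv n f u *
      (√(2 * n + 1) * sphericalBessel n (Real.pi * (z - u)))) (f z) := by
  simpa using hasSum_chromatic_add hf u (z - u)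

/-! ### Integrals of Legendre polynomials -/

lemma eval_iterate_derivative_rodrigues {n k : ℕ} (hk : k < n) {x : ℝ} (hx : x ^ 2 = 1) :
    (Polynomial.derivative^[k] ((Polynomial.X ^ 2 - 1 : Polynomial ℝ) ^ n)).eval x = 0 := by
  obtain ⟨r, hr⟩ := Polynomial.pow_sub_dvd_iterate_derivative_pow
    (Polynomial.X ^ 2 - 1 : Polynomial ℝ) n k
  rw [hr, Polynomial.eval_mul, Polynomial.eval_pow]
  simp [hx, Nat.sub_ne_zero_of_lt hk]

/-- Repeated integration by parts: the boundary terms vanish because `±1` are zeros of order `n`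
of `(X² - 1)ⁿ`. -/
lemma integral_iterate_derivative_mul (n : ℕ) {k : ℕ} (hk : k ≤ n) (q : Polynomial ℝ) :
    ∫ x in (-1 : ℝ)..1,
        (Polynomial.derivative^[k] ((Polynomial.X ^ 2 - 1 : Polynomial ℝ) ^ n)).eval x * q.eval x =
      (-1) ^ k * ∫ x in (-1 : ℝ)..1, (x ^ 2 - 1) ^ n * (Polynomial.derivative^[k] q).eval x := by
  induction k generalizing q with
  | zero => simp
  | succ k ih =>
    have h := intervalIntegral.integral_mul_deriv_eq_deriv_mul (a := -1) (b := 1)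
      (u := fun x => q.eval x) (u' := fun x => q.derivative.eval x)
      (v := fun x => (Polynomial.derivative^[k]
        ((Polynomial.X ^ 2 - 1 : Polynomial ℝ) ^ n)).eval x)
      (v' := fun x => (Polynomial.derivative^[k + 1]
        ((Polynomial.X ^ 2 - 1 : Polynomial ℝ) ^ n)).eval x)
      (fun x _ => q.hasDerivAt x)
      (fun x _ => by
        rw [Function.iterate_succ_apply']
        exact Polynomial.hasDerivAt _ x)
      ((Polynomial.continuous _).intervalIntegrable _ _)
      ((Polynomial.continuous _).intervalIntegrable _ _)
    rw [eval_iterate_derivative_rodrigues (Nat.lt_of_succ_le hk) (by norm_num),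
      eval_iterate_derivative_rodrigues (Nat.lt_of_succ_le hk) (by norm_num)] at h
    have h2 := ih (Nat.le_of_succ_le hk) q.derivative
    simp only [mul_comm (Polynomial.eval _ q), mul_comm (Polynomial.eval _ q.derivative)] at h
    rw [h, h2, Function.iterate_succ_apply, pow_succ]
    ring

lemma integral_legendre_mul (n : ℕ) (q : Polynomial ℝ) :
    ∫ x in (-1 : ℝ)..1, (legendre n).eval x * q.eval x =
      1 / (2 ^ n * n !) *
        ∫ x in (-1 : ℝ)..1, (1 - x ^ 2) ^ n * (Polynomial.derivative^[n] q).eval x := by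
  simp only [legendre, Polynomial.eval_mul, Polynomial.eval_C, mul_assoc]
  rw [intervalIntegral.integral_const_mul, integral_iterate_derivative_mul n le_rfl,
    ← intervalIntegral.integral_const_mul]
  simp only [← mul_assoc, ← mul_pow]
  simp

/-- A Beta integral, computed by the recursion that comes from splitting off one factor
`1 - x²`. -/
lemma integral_one_sub_sq_pow_mul_even (n k : ℕ) :
    ∫ x in (-1 : ℝ)..1, (1 - x ^ 2) ^ n * x ^ (2 * k) =
      (2 : ℝ) ^ (n + 1) * n ! * ((2 * k + 1)‼ : ℕ) / ((2 * (k : ℝ) + 1) * ((2 * (n + k) + 1)‼ : ℕ)) := by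
  induction n generalizing k with
  | zero =>
    have h : (((2 * k + 1)‼ : ℕ) : ℝ) ≠ 0 := by exact_mod_cast (doubleFactorial_pos _).ne'
    simp only [pow_zero, one_mul, integral_pow]
    rw [Odd.neg_one_pow ⟨k, by ring⟩, zero_add, zero_add, Nat.factorial_zero, Nat.cast_one]
    push_cast
    field_simp
    norm_num
  | succ n ih =>
    have e : ∀ x : ℝ, (1 - x ^ 2) ^ (n + 1) * x ^ (2 * k) =
        (1 - x ^ 2) ^ n * x ^ (2 * k) - (1 - x ^ 2) ^ n * x ^ (2 * (k + 1)) := fun x => by ring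
    simp only [e]
    rw [intervalIntegral.integral_sub (by apply Continuous.intervalIntegrable; fun_prop)
      (by apply Continuous.intervalIntegrable; fun_prop), ih, ih,
      show n + (k + 1) = (n + k) + 1 by ring, show n + 1 + k = (n + k) + 1 by ring,
      doubleFactorial_odd_succ, doubleFactorial_odd_succ, Nat.factorial_succ]
    have h : (((2 * (n + k) + 1)‼ : ℕ) : ℝ) ≠ 0 := by exact_mod_cast (doubleFactorial_pos _).ne'
    have h1 : (2 * ((n : ℝ) + k) + 3) ≠ 0 := by positivity
    have h2 : (2 * (k : ℝ) + 3) ≠ 0 := by positivity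
    push_cast
    rw [show 2 * ((k : ℝ) + 1) + 1 = 2 * k + 3 by ring]
    field_simp
    ring

lemma integral_one_sub_sq_pow_mul_odd (n k : ℕ) :
    ∫ x in (-1 : ℝ)..1, (1 - x ^ 2) ^ n * x ^ (2 * k + 1) = 0 := by
  have h := intervalIntegral.integral_comp_neg (a := -1) (b := 1)
    (fun x : ℝ => (1 - x ^ 2) ^ n * x ^ (2 * k + 1))
  simp only [neg_sq, Odd.neg_pow (n := 2 * k + 1) ⟨k, rfl⟩, mul_neg, neg_neg,
    intervalIntegral.integral_neg] at h
  linarith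

lemma integral_legendre_mul_pow_eq_zero {n m : ℕ} (h : ∀ k, m ≠ n + 2 * k) :
    ∫ x in (-1 : ℝ)..1, (legendre n).eval x * x ^ m = 0 := by
  have := integral_legendre_mul n (Polynomial.X ^ m)
  simp only [Polynomial.eval_pow, Polynomial.eval_X,
    Polynomial.iterate_derivative_X_pow_eq_smul] at this
  rw [this]
  rcases lt_or_ge m n with hm | hm
  · simp [Nat.descFactorial_eq_zero_iff_lt.mpr hm]
  · obtain ⟨j, rfl⟩ := Nat.exists_eq_add_of_le hm
    rcases Nat.even_or_odd' j with ⟨i, rfl | rfl⟩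
    · exact absurd rfl (h i)
    · rw [show n + (2 * i + 1) - n = 2 * i + 1 by omega]
      simp only [Polynomial.eval_smul, Polynomial.eval_pow, Polynomial.eval_X,
        smul_eq_mul, mul_left_comm _ (Nat.cast _ : ℝ)]
      rw [intervalIntegral.integral_const_mul, integral_one_sub_sq_pow_mul_odd]
      simp

lemma integral_legendre_mul_pow (n k : ℕ) :
    ∫ x in (-1 : ℝ)..1, (legendre n).eval x * x ^ (n + 2 * k) =
      2 * (n + 2 * k)! / (2 ^ k * k ! * ((2 * n + 2 * k + 1)‼ : ℕ)) := by
  have := integral_legendre_mul n (Polynomial.X ^ (n + 2 * k))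
  simp only [Polynomial.eval_pow, Polynomial.eval_X,
    Polynomial.iterate_derivative_X_pow_eq_smul] at this
  rw [this, show n + 2 * k - n = 2 * k by omega]
  simp only [Polynomial.eval_smul, Polynomial.eval_pow, Polynomial.eval_X,
    smul_eq_mul, mul_left_comm _ (Nat.cast _ : ℝ)]
  rw [intervalIntegral.integral_const_mul, integral_one_sub_sq_pow_mul_even]
  have h1 : ((2 * k)! : ℝ) * (n + 2 * k).descFactorial n = (n + 2 * k)! := by
    have := Nat.factorial_mul_descFactorial (n := n + 2 * k) (k := n) (by omega)
    rw [show n + 2 * k - n = 2 * k by omega] at this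
    exact_mod_cast this
  have h2 := factorial_two_mul k
  have h : (((2 * n + 2 * k + 1)‼ : ℕ) : ℝ) ≠ 0 := by exact_mod_cast (doubleFactorial_pos _).ne'
  have h' : (((2 * k + 1)‼ : ℕ) : ℝ) ≠ 0 := by exact_mod_cast (doubleFactorial_pos _).ne'
  rw [show 2 * (n + k) + 1 = 2 * n + 2 * k + 1 by ring, ← h1]
  have h3 : ((2 * k)! : ℝ) = 2 ^ k * k ! * ((2 * k + 1)‼ : ℕ) / (2 * k + 1) := by
    rw [← h2]; field_simp
  rw [h3, pow_succ]
  field_simp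

lemma legendre_natDegree_le (n : ℕ) : (legendre n).natDegree ≤ n :=
  Polynomial.natDegree_le_iff_coeff_eq_zero.mpr fun k hk => legendre_coeff_eq_zero (by omega)

lemma integral_legendre_mul_legendre_of_lt {n m : ℕ} (h : m < n) :
    ∫ x in (-1 : ℝ)..1, (legendre n).eval x * (legendre m).eval x = 0 := by
  rw [integral_legendre_mul,
    Polynomial.iterate_derivative_eq_zero ((legendre_natDegree_le m).trans_lt h)]
  simp

lemma integral_legendre_sq (n : ℕ) :
    ∫ x in (-1 : ℝ)..1, (legendre n).eval x * (legendre n).eval x = 2 / (2 * n + 1) := by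
  have hd : Polynomial.derivative^[n] (legendre n) =
      Polynomial.C ((n ! : ℝ) * (legendre n).coeff n) := by
    have h0 : (Polynomial.derivative^[n] (legendre n)).natDegree = 0 := by
      have h1 := Polynomial.natDegree_iterate_derivative (legendre n) n
      have h2 := legendre_natDegree_le n
      omega
    rw [Polynomial.eq_C_of_natDegree_eq_zero h0, Polynomial.coeff_iterate_derivative]
    simp [Nat.descFactorial_self]
  have hc := legendre_coeff_add_two_mul n 0
  have hi := integral_one_sub_sq_pow_mul_even n 0
  have h : (((2 * n + 1)‼ : ℕ) : ℝ) ≠ 0 := by exact_mod_cast (doubleFactorial_pos _).ne'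
  simp [gegenbauerCoeff] at hc hi
  rw [integral_legendre_mul, hd]
  simp only [Polynomial.eval_C]
  rw [intervalIntegral.integral_mul_const, hi]
  have h1 : (2 * (n : ℝ) + 1) ≠ 0 := by positivity
  have hc' : (n ! : ℝ) * (legendre n).coeff n = ((2 * n + 1)‼ : ℕ) / (2 * n + 1) := by
    rw [mul_div_cancel_left₀ _ h1] at hc
    rw [← hc]; field_simp
  rw [hc', pow_succ]
  field_simp

/-- The spherical Bessel functions are the Fourier transforms of the Legendre polynomials. -/
lemma integral_legendre_mul_exp (n : ℕ) (w : ℂ) :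
    ∫ x in (-1 : ℝ)..1, (((legendre n).eval x : ℝ) : ℂ) * Complex.exp (-Complex.I * w * x) =
      2 * (-Complex.I) ^ n * sphericalBessel n w := by
  have hcont : Continuous fun x : ℝ => (legendre n).eval x := Polynomial.continuous _
  have h1 : HasSum (fun m : ℕ => ∫ x in (-1 : ℝ)..1,
      (((legendre n).eval x : ℝ) : ℂ) * ((-Complex.I * w * x) ^ m / m !))
      (∫ x in (-1 : ℝ)..1, (((legendre n).eval x : ℝ) : ℂ) * Complex.exp (-Complex.I * w * x)) := by
    refine intervalIntegral.hasSum_integral_of_dominated_convergence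
      (fun m x => |(legendre n).eval x| * (‖w‖ ^ m / m !)) (fun m => ?_) (fun m => ?_) ?_ ?_ ?_
    · apply Continuous.aestronglyMeasurable; fun_prop
    · refine Eventually.of_forall fun x hx => ?_
      rw [Set.uIoc_of_le (by norm_num)] at hx
      have hx' : |x| ≤ 1 := abs_le.mpr ⟨hx.1.le, hx.2⟩
      simp only [norm_mul, norm_div, norm_pow, norm_neg, Complex.norm_I, one_mul,
        Complex.norm_real, Real.norm_eq_abs, Complex.norm_natCast]
      gcongr
      exact mul_le_of_le_one_right (norm_nonneg _) hx'
    · exact Eventually.of_forall fun x _ => (Real.summable_pow_div_factorial _).mul_left _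
    · simp only [tsum_mul_left]
      apply Continuous.intervalIntegrable; fun_prop
    · refine Eventually.of_forall fun x _ => HasSum.mul_left _ ?_
      rw [Complex.exp_eq_exp_ℂ]
      exact NormedSpace.expSeries_div_hasSum_exp _
  have h2 : ∀ m : ℕ, ∫ x in (-1 : ℝ)..1,
      (((legendre n).eval x : ℝ) : ℂ) * ((-Complex.I * w * x) ^ m / m !) =
      (-Complex.I * w) ^ m / m ! * ((∫ x in (-1 : ℝ)..1, (legendre n).eval x * x ^ m : ℝ) : ℂ) := by
    intro m
    rw [← intervalIntegral.integral_ofReal, ← intervalIntegral.integral_const_mul]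
    refine intervalIntegral.integral_congr fun x _ => ?_
    simp only [mul_pow]
    push_cast
    ring
  -- only the moments of order `n + 2k` survive
  simp only [h2] at h1
  have hinj : Function.Injective fun k => n + 2 * k := fun a b h => by simpa using h
  rw [← hinj.hasSum_iff] at h1
  · refine h1.unique (((hasSum_besselTerm n w).mul_left _).congr_fun fun k => ?_)
    simp only [Function.comp, integral_legendre_mul_pow, besselTerm]
    have h8 : ((((n + 2 * k)!) : ℕ) : ℂ) ≠ 0 := Nat.cast_ne_zero.mpr (factorial_pos _).ne'
    have h9 : (-Complex.I) ^ (n + 2 * k) = (-Complex.I) ^ n * (-1) ^ k := by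
      rw [pow_add, pow_mul, neg_sq, Complex.I_sq]
    push_cast
    rw [mul_pow, h9, div_pow, neg_pow (w ^ 2), ← pow_mul, pow_add w]
    field_simp
  · intro m hm
    rw [integral_legendre_mul_pow_eq_zero fun k hk => hm ⟨k, hk.symm⟩]
    simp

/-! ### Chromatic derivatives of inverse Fourier transforms on the band -/

/-- Lebesgue measure on the frequency band `[-1/2, 1/2]`. In Mathlib's normalization of the Fourier
transform this is the band `[-π, π]` of angular frequencies. -/
noncomputable def band : Measure ℝ := volume.restrict (Set.Icc (-1 / 2) (1 / 2))

instance : IsProbabilityMeasure band :=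
  ⟨by norm_num [band]⟩

lemma ae_band_abs_le : ∀ᵐ ξ ∂band, |ξ| ≤ 1 / 2 := by
  refine (ae_restrict_mem measurableSet_Icc).mono fun ξ hξ => abs_le.mpr ⟨?_, hξ.2⟩
  linarith [hξ.1]

lemma integral_band {E : Type*} [NormedAddCommGroup E] [NormedSpace ℝ E] (g : ℝ → E) :
    ∫ ξ, g ξ ∂band = ∫ ξ in (-1 / 2 : ℝ)..(1 / 2), g ξ := by
  rw [intervalIntegral.integral_of_le (by norm_num), band, integral_Icc_eq_integral_Ioc]

lemma integrable_continuous_mul_band {g p : ℝ → ℂ} (hg : Integrable g band) (hp : Continuous p) :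
    Integrable (fun ξ => p ξ * g ξ) band :=
  IntegrableOn.continuousOn_mul hp.continuousOn hg isCompact_Icc

/-- The inverse Fourier transform of a function on the band, at complex arguments. -/
noncomputable def bandTransform (g : ℝ → ℂ) (z : ℂ) : ℂ :=
  ∫ ξ, Complex.exp (2 * Real.pi * Complex.I * ξ * z) * g ξ ∂band

lemma norm_exp_band_le {ξ : ℝ} (hξ : |ξ| ≤ 1 / 2) (z : ℂ) :
    ‖Complex.exp (2 * Real.pi * Complex.I * ξ * z)‖ ≤ Real.exp (Real.pi * ‖z‖) := by
  refine (Complex.norm_exp_le_exp_norm _).trans (Real.exp_le_exp.mpr ?_)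
  have hpi := Real.pi_pos
  simp only [norm_mul, Complex.norm_I, Complex.norm_real, Real.norm_eq_abs, Complex.norm_ofNat,
    abs_of_pos hpi, mul_one]
  have := mul_le_mul_of_nonneg_right hξ (mul_nonneg hpi.le (norm_nonneg z))
  nlinarith

lemma hasDerivAt_bandTransform {g : ℝ → ℂ} (hg : Integrable g band) (z : ℂ) :
    HasDerivAt (bandTransform g)
      (bandTransform (fun ξ => (2 * Real.pi * Complex.I * ξ) * g ξ) z) z := by
  have hpi := Real.pi_pos
  refine (hasDerivAt_integral_of_dominated_loc_of_deriv_le (μ := band) (s := Metric.ball z 1)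
    (F := fun z ξ => Complex.exp (2 * Real.pi * Complex.I * ξ * z) * g ξ)
    (F' := fun z ξ => Complex.exp (2 * Real.pi * Complex.I * ξ * z) *
      ((2 * Real.pi * Complex.I * ξ) * g ξ))
    (bound := fun ξ => Real.exp (Real.pi * (‖z‖ + 1)) * (Real.pi * ‖g ξ‖))
    (Metric.ball_mem_nhds z one_pos) ?_ ?_ ?_ ?_ ?_ ?_).2
  · exact Eventually.of_forall fun x =>
      (integrable_continuous_mul_band hg (by fun_prop)).aestronglyMeasurable
  · exact integrable_continuous_mul_band hg (by fun_prop)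
  · exact (integrable_continuous_mul_band (integrable_continuous_mul_band hg (by fun_prop))
      (by fun_prop)).aestronglyMeasurable
  · filter_upwards [ae_band_abs_le] with ξ hξ x hx
    rw [norm_mul, norm_mul]
    have h1 : ‖x‖ ≤ ‖z‖ + 1 := by
      have := norm_sub_norm_le x z
      have h2 := mem_ball_iff_norm.mp hx
      linarith
    have h2 : ‖2 * (Real.pi : ℂ) * Complex.I * ξ‖ ≤ Real.pi := by
      simp only [norm_mul, Complex.norm_I, Complex.norm_real, Real.norm_eq_abs,
        Complex.norm_ofNat, abs_of_pos hpi, mul_one]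
      nlinarith
    gcongr
    exact (norm_exp_band_le hξ x).trans (Real.exp_le_exp.mpr (by gcongr))
  · exact (hg.norm.const_mul _).const_mul _
  · refine Eventually.of_forall fun ξ x _ => ?_
    have := (((hasDerivAt_id x).const_mul (2 * Real.pi * Complex.I * ξ)).cexp).mul_const (g ξ)
    refine this.congr_deriv ?_
    simp only [id, mul_one]
    ring

lemma differentiable_bandTransform {g : ℝ → ℂ} (hg : Integrable g band) :
    Differentiable ℂ (bandTransform g) :=
  fun z => (hasDerivAt_bandTransform hg z).differentiableAt

lemma iteratedDeriv_bandTransform {g : ℝ → ℂ} (hg : Integrable g band) (k : ℕ) :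
    iteratedDeriv k (bandTransform g) =
      bandTransform (fun ξ => (2 * Real.pi * Complex.I * ξ) ^ k * g ξ) := by
  induction k with
  | zero => simp
  | succ k ih =>
    rw [iteratedDeriv_succ, ih]
    funext z
    rw [(hasDerivAt_bandTransform (integrable_continuous_mul_band hg (by fun_prop)) z).deriv]
    simp only [_root_.pow_succ', mul_assoc]

/-- The chromatic derivatives are the differential operators whose symbols are the orthonormal
Legendre polynomials. -/
lemma chromaticDeriv_bandTransform {g : ℝ → ℂ} (hg : Integrable g band) (n : ℕ) (z : ℂ) :
    chromaticDeriv n (bandTransform g) z = (-Complex.I) ^ n *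
      bandTransform (fun ξ => (((orthoLegendre n).eval (-2 * Real.pi * ξ) : ℝ) : ℂ) * g ξ) z := by
  have hdeg : (orthoLegendre n).natDegree < n + 1 := Nat.lt_succ_of_le
    (Polynomial.natDegree_le_iff_coeff_eq_zero.mpr fun k hk => orthoLegendre_coeff_of_lt hk)
  rw [chromaticDeriv_eq_sum, ← mul_sum]
  congr 1
  simp only [iteratedDeriv_bandTransform hg, bandTransform, ← integral_const_mul]
  rw [← integral_finsetSum]
  · refine integral_congr_ae (Eventually.of_forall fun ξ => ?_)
    simp only [Polynomial.eval_eq_sum_range' hdeg]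
    push_cast
    rw [sum_mul, mul_sum]
    refine sum_congr rfl fun k _ => ?_
    have : (-2 * (Real.pi : ℂ) * ξ) ^ k = Complex.I ^ k * (2 * Real.pi * Complex.I * ξ) ^ k := by
      rw [← mul_pow]
      congr 1
      linear_combination (-2 * (Real.pi : ℂ) * ξ) * Complex.I_mul_I
    rw [this]
    ring
  · intro k _
    exact ((integrable_continuous_mul_band (integrable_continuous_mul_band hg (by fun_prop))
      (by fun_prop))).const_mul _

lemma sinc_eq_bandTransform : sinc = bandTransform 1 := by
  funext z
  simp only [bandTransform, Pi.one_apply, mul_one, integral_band]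
  have hpi : (Real.pi : ℂ) ≠ 0 := Complex.ofReal_ne_zero.mpr Real.pi_ne_zero
  rcases eq_or_ne z 0 with rfl | hz
  · simp [sinc]; norm_num
  · have hc : 2 * Real.pi * Complex.I * z ≠ 0 := by simp [hpi, hz]
    have e : ∀ ξ : ℝ, 2 * Real.pi * Complex.I * ξ * z = (2 * Real.pi * Complex.I * z) * ξ :=
      fun ξ => by ring
    simp only [e, integral_exp_mul_complex hc, sinc, if_neg hz, Complex.sin]
    have h1 : 2 * Real.pi * Complex.I * z * ((1 / 2 : ℝ) : ℂ) = Real.pi * z * Complex.I := by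
      push_cast; ring
    have h2 : 2 * Real.pi * Complex.I * z * ((-1 / 2 : ℝ) : ℂ) = -(Real.pi * z) * Complex.I := by
      push_cast; ring
    rw [h1, h2]
    field_simp
    linear_combination (Complex.exp (-(Real.pi * z * Complex.I)) -
      Complex.exp (Real.pi * z * Complex.I)) * Complex.I_mul_I

lemma orthoLegendre_eval (n : ℕ) (x : ℝ) :
    (orthoLegendre n).eval x = √(2 * n + 1) * (legendre n).eval (x / Real.pi) := by
  simp [orthoLegendre, Polynomial.eval_comp, div_eq_inv_mul]

lemma orthoLegendre_eval_band (n : ℕ) (ξ : ℝ) :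
    (orthoLegendre n).eval (-2 * Real.pi * ξ) = √(2 * n + 1) * (legendre n).eval (-2 * ξ) := by
  rw [orthoLegendre_eval, mul_right_comm, mul_div_cancel_right₀ _ Real.pi_ne_zero]

lemma bandTransform_orthoLegendre (n : ℕ) (z : ℂ) :
    bandTransform (fun ξ => (((orthoLegendre n).eval (-2 * Real.pi * ξ) : ℝ) : ℂ)) z =
      (-Complex.I) ^ n * (√(2 * n + 1) * sphericalBessel n (Real.pi * z)) := by
  have h := integral_legendre_mul_exp n (Real.pi * z)
  have h2 := intervalIntegral.integral_comp_mul_left (a := -1 / 2) (b := 1 / 2)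
    (fun x : ℝ => (((legendre n).eval x : ℝ) : ℂ) *
      Complex.exp (-Complex.I * (Real.pi * z) * x)) (c := -2) (by norm_num)
  rw [show (-2 : ℝ) * (-1 / 2) = 1 by norm_num, show (-2 : ℝ) * (1 / 2) = -1 by norm_num,
    intervalIntegral.integral_symm (-1 : ℝ) 1, h] at h2
  simp only [bandTransform, integral_band, orthoLegendre_eval_band]
  have e : ∀ ξ : ℝ, Complex.exp (2 * Real.pi * Complex.I * ξ * z) *
      ((√(2 * n + 1) * (legendre n).eval (-2 * ξ) : ℝ) : ℂ) = (√(2 * n + 1) : ℂ) *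
        ((((legendre n).eval (-2 * ξ) : ℝ) : ℂ) *
          Complex.exp (-Complex.I * (Real.pi * z) * ((-2 * ξ : ℝ) : ℂ))) := fun ξ => by
    rw [show -Complex.I * (Real.pi * z) * ((-2 * ξ : ℝ) : ℂ) =
      2 * Real.pi * Complex.I * ξ * z by push_cast; ring]
    push_cast; ring
  simp only [e]
  rw [intervalIntegral.integral_const_mul, h2, Complex.real_smul]
  push_cast
  ring

lemma chromaticDeriv_sinc (n : ℕ) (z : ℂ) :
    chromaticDeriv n sinc z = (-1) ^ n * (√(2 * n + 1) * sphericalBessel n (Real.pi * z)) := by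
  rw [sinc_eq_bandTransform, chromaticDeriv_bandTransform (g := 1) (integrable_const 1)]
  simp only [Pi.one_apply, mul_one]
  rw [bandTransform_orthoLegendre, ← mul_assoc, ← mul_pow]
  simp

lemma sinc_neg (z : ℂ) : sinc (-z) = sinc z := by
  simp [sinc]

lemma chromaticDeriv_sinc_sub (n : ℕ) (z u : ℂ) :
    chromaticDeriv n (fun v => sinc (z - v)) u =
      √(2 * n + 1) * sphericalBessel n (Real.pi * (z - u)) := by
  have h : (fun v => sinc (z - v)) = fun v => sinc (v - z) := by
    funext v
    rw [← sinc_neg, neg_sub]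
  have h2 : chromaticDeriv n (fun v => sinc (z - v)) u = chromaticDeriv n sinc (u - z) := by
    simp only [h, chromaticDeriv, iteratedDeriv_comp_sub_const]
  rw [h2, chromaticDeriv_sinc, show (Real.pi : ℂ) * (u - z) = -(Real.pi * (z - u)) by ring,
    sphericalBessel_neg, mul_left_comm (√(2 * n + 1) : ℂ), ← mul_assoc, ← mul_pow]
  simp

/-! ### The Plancherel transform on the intersection of L¹ and L² -/

/-- On `L¹ ∩ L²` the inverse Plancherel transform is given by the Fourier integral. -/
lemma fourierInv_toLp_ae_eq {g : ℝ → ℂ} (hg : Integrable g) (hg2 : MemLp g 2) :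
    (𝓕⁻ (hg2.toLp g) : Lp ℂ 2 (volume : Measure ℝ)) =ᵐ[volume] 𝓕⁻ g := by
  have hcont : Continuous (𝓕⁻ g) :=
    VectorFourier.fourierIntegral_continuous Real.continuous_fourierChar
      (L := -innerₗ ℝ) (by fun_prop) hg
  refine ae_eq_of_integral_contDiff_smul_eq ((Lp.memLp _).locallyIntegrable (by norm_num))
    hcont.locallyIntegrable fun p hp hpc => ?_
  have hc : HasCompactSupport (Complex.ofRealCLM ∘ p) := hpc.comp_left rfl
  have hd : ContDiff ℝ ∞ (Complex.ofRealCLM ∘ p) := by fun_prop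
  set ψ : 𝓢(ℝ, ℂ) := hc.toSchwartzMap hd
  have h1 : ∀ x, ψ x = (p x : ℂ) := fun x => rfl
  have h2 := congrArg (fun T : 𝓢'(ℝ, ℂ) => T ψ)
    (Lp.fourierInv_toTemperedDistribution_eq (hg2.toLp g))
  simp only [TemperedDistribution.fourierInv_apply, Lp.toTemperedDistribution_apply, h1] at h2
  have h3 := VectorFourier.integral_fourierIntegral_smul_eq_flip (μ := (volume : Measure ℝ))
    (ν := (volume : Measure ℝ)) (L := -innerₗ ℝ) (f := ψ) (g := g) Real.continuous_fourierChar
    (by fun_prop) ψ.integrable hg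
  have h4 : (-innerₗ ℝ : ℝ →ₗ[ℝ] ℝ →ₗ[ℝ] ℝ).flip = -innerₗ ℝ := by
    ext; simp
  rw [h4] at h3
  calc ∫ x, p x • (𝓕⁻ (hg2.toLp g) : Lp ℂ 2 (volume : Measure ℝ)) x
      = ∫ x, (p x : ℂ) • (𝓕⁻ (hg2.toLp g) : Lp ℂ 2 (volume : Measure ℝ)) x := by
        simp
    _ = ∫ x, (𝓕⁻ ψ) x • (hg2.toLp g) x := h2.symm
    _ = ∫ x, (𝓕⁻ (ψ : ℝ → ℂ)) x • g x := by
        refine integral_congr_ae ?_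
        filter_upwards [hg2.coeFn_toLp] with x hx
        rw [hx, SchwartzMap.fourierInv_coe]
    _ = ∫ x, ψ x • (𝓕⁻ g) x := h3
    _ = _ := integral_congr_ae (Eventually.of_forall fun x => by simp [h1])

/-! ### Band limited functions and the Legendre basis of the band -/

lemma memLp_indicator_band {g : ℝ → ℂ} (hg : MemLp g 2 band) :
    MemLp ((Set.Icc (-1 / 2 : ℝ) (1 / 2)).indicator g) 2 :=
  (memLp_indicator_iff_restrict measurableSet_Icc).mpr hg

lemma fourierInv_indicator_band (g : ℝ → ℂ) (t : ℝ) :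
    𝓕⁻ ((Set.Icc (-1 / 2 : ℝ) (1 / 2)).indicator g) t = bandTransform g t := by
  rw [Real.fourierInv_eq', bandTransform, band, ← integral_indicator measurableSet_Icc]
  refine integral_congr_ae (Eventually.of_forall fun ξ => ?_)
  simp only [Set.indicator_apply, smul_eq_mul, mul_ite, mul_zero]
  congr 3
  simp
  ring

/-- On the real line the inverse transform of a square integrable function on the band is its
inverse Plancherel transform. -/
lemma fourierInv_toLp_indicator_band {g : ℝ → ℂ} (hg : MemLp g 2 band) :
    (𝓕⁻ ((memLp_indicator_band hg).toLp _) : Lp ℂ 2 (volume : Measure ℝ)) =ᵐ[volume]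
      fun t : ℝ => bandTransform g t := by
  have hi : Integrable ((Set.Icc (-1 / 2 : ℝ) (1 / 2)).indicator g) :=
    (integrable_indicator_iff measurableSet_Icc).mpr (hg.integrable (by norm_num))
  refine (fourierInv_toLp_ae_eq hi (memLp_indicator_band hg)).trans ?_
  exact Eventually.of_forall (fourierInv_indicator_band g)

lemma memLp_bandTransform {g : ℝ → ℂ} (hg : MemLp g 2 band) :
    MemLp (fun t : ℝ => bandTransform g t) 2 :=
  (memLp_congr_ae (fourierInv_toLp_indicator_band hg)).mp (Lp.memLp _)

lemma toLp_bandTransform {g : ℝ → ℂ} (hg : MemLp g 2 band) :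
    (memLp_bandTransform hg).toLp _ = 𝓕⁻ ((memLp_indicator_band hg).toLp _) :=
  Lp.ext (((memLp_bandTransform hg).coeFn_toLp).trans (fourierInv_toLp_indicator_band hg).symm)

lemma continuous_bandTransform_ofReal {g : ℝ → ℂ} (hg : MemLp g 2 band) :
    Continuous (fun t : ℝ => bandTransform g t) :=
  (differentiable_bandTransform (hg.integrable (by norm_num))).continuous.comp
    Complex.continuous_ofReal

lemma bandTransform_mem_BL {g : ℝ → ℂ} (hg : MemLp g 2 band) :
    (fun t : ℝ => bandTransform g t) ∈ BL := by
  refine ⟨continuous_bandTransform_ofReal hg, memLp_bandTransform hg, ?_⟩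
  rw [toLp_bandTransform hg, FourierTransform.fourier_fourierInv_eq]
  filter_upwards [(memLp_indicator_band hg).coeFn_toLp] with ξ hξ h
  rw [hξ]
  refine Set.indicator_of_notMem (fun hm => h.not_ge ?_) g
  have hpi := Real.pi_pos
  have : |ξ| ≤ 1 / 2 := abs_le.mpr ⟨by linarith [hm.1], hm.2⟩
  rw [abs_mul, abs_of_pos (by positivity)]
  nlinarith

/-- Plancherel's theorem on the band. -/
lemma eLpNorm_bandTransform {g : ℝ → ℂ} (hg : MemLp g 2 band) :
    eLpNorm (fun t : ℝ => bandTransform g t) 2 volume = eLpNorm g 2 band := by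
  have h : ‖(memLp_bandTransform hg).toLp _‖ = ‖(memLp_indicator_band hg).toLp _‖ := by
    rw [toLp_bandTransform hg, ← Lp.norm_fourier_eq, FourierTransform.fourier_fourierInv_eq]
  rw [Lp.norm_toLp, Lp.norm_toLp, ENNReal.toReal_eq_toReal_iff' (memLp_bandTransform hg).2.ne
    (memLp_indicator_band hg).2.ne, eLpNorm_indicator_eq_eLpNorm_restrict measurableSet_Icc] at h
  exact h

lemma norm_bandTransform_ofReal_le {g : ℝ → ℂ} (hg : MemLp g 2 band) (t : ℝ) :
    ‖bandTransform g t‖ ≤ (eLpNorm g 2 band).toReal := by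
  have h1 : ‖bandTransform g t‖ ≤ ∫ ξ, ‖g ξ‖ ∂band := by
    refine (norm_integral_le_integral_norm _).trans (le_of_eq ?_)
    refine integral_congr_ae (Eventually.of_forall fun ξ => ?_)
    have : 2 * Real.pi * Complex.I * ξ * t = ((2 * Real.pi * ξ * t : ℝ) : ℂ) * Complex.I := by
      push_cast; ring
    simp only [norm_mul, this, Complex.norm_exp_ofReal_mul_I, one_mul]
  refine h1.trans ?_
  have h2 : eLpNorm g 1 band ≤ eLpNorm g 2 band :=
    eLpNorm_le_eLpNorm_of_exponent_le (by norm_num) hg.1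
  rw [eLpNorm_one_eq_lintegral_enorm] at h2
  rw [integral_norm_eq_lintegral_enorm hg.1]
  exact ENNReal.toReal_mono hg.2.ne h2

/-- The Paley–Wiener representation: an entire function whose restriction to the real line is band
limited is the inverse Fourier transform of a square integrable function on the band. -/
lemma exists_eq_bandTransform {f : ℂ → ℂ} (hf : Differentiable ℂ f)
    (hBL : (fun t : ℝ => f t) ∈ BL) : ∃ g, MemLp g 2 band ∧ f = bandTransform g := by
  obtain ⟨hc, hL, h0⟩ := hBL
  set g : ℝ → ℂ := ⇑(𝓕 (hL.toLp _) : Lp ℂ 2 (volume : Measure ℝ))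
  have hg : MemLp g 2 band := (Lp.memLp _).restrict _
  refine ⟨g, hg, ?_⟩
  have h1 : (memLp_indicator_band hg).toLp _ = 𝓕 (hL.toLp _) := by
    refine Lp.ext ((memLp_indicator_band hg).coeFn_toLp.trans ?_)
    filter_upwards [h0] with ξ hξ
    by_cases hm : ξ ∈ Set.Icc (-1 / 2 : ℝ) (1 / 2)
    · rw [Set.indicator_of_mem hm]
    · rw [Set.indicator_of_notMem hm]
      refine (hξ ?_).symm
      have hpi := Real.pi_pos
      have : 1 / 2 < |ξ| := by
        by_contra! h
        have := abs_le.mp h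
        exact hm ⟨by linarith, by linarith⟩
      rw [abs_mul, abs_of_pos (by positivity)]
      nlinarith
  have h2 := fourierInv_toLp_indicator_band hg
  rw [h1, FourierTransform.fourierInv_fourier_eq] at h2
  have h3 : (fun t : ℝ => f t) = fun t : ℝ => bandTransform g t :=
    (hc.ae_eq_iff_eq volume (continuous_bandTransform_ofReal hg)).mp (hL.coeFn_toLp.symm.trans h2)
  -- both sides are entire and agree on the real line, which accumulates at `0`
  have ha : AnalyticOnNhd ℂ f Set.univ := fun z _ => hf.analyticAt z
  have hb : AnalyticOnNhd ℂ (bandTransform g) Set.univ := fun z _ =>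
    (differentiable_bandTransform (hg.integrable (by norm_num))).analyticAt z
  refine ha.eq_of_frequently_eq hb (z₀ := 0) ?_
  have ht : Tendsto (fun t : ℝ => (t : ℂ)) (𝓝[≠] 0) (𝓝[≠] 0) := by
    refine tendsto_nhdsWithin_iff.mpr ⟨?_, ?_⟩
    · exact (Complex.continuous_ofReal.tendsto' 0 0 (by simp)).mono_left nhdsWithin_le_nhds
    · filter_upwards [self_mem_nhdsWithin] with t ht
      exact Complex.ofReal_ne_zero.mpr ht
  exact ht.frequently (Eventually.of_forall fun t => congrFun h3 t).frequently

/-- The orthonormal Legendre polynomials on the band, reflected so that they are the symbols of the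
chromatic derivatives. -/
noncomputable def bandLegendre (n : ℕ) (ξ : ℝ) : ℂ :=
  (((orthoLegendre n).eval (-2 * Real.pi * ξ) : ℝ) : ℂ)

lemma continuous_bandLegendre (n : ℕ) : Continuous (bandLegendre n) := by
  have : Continuous fun x => (orthoLegendre n).eval x := Polynomial.continuous _
  unfold bandLegendre
  fun_prop

lemma memLp_continuous_mul_band {g p : ℝ → ℂ} (hg : MemLp g 2 band) (hp : Continuous p) :
    MemLp (fun ξ => p ξ * g ξ) 2 band := by
  obtain ⟨C, hC⟩ := isCompact_Icc.exists_bound_of_continuousOn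
    (s := Set.Icc (-1 / 2 : ℝ) (1 / 2)) hp.continuousOn
  refine MemLp.of_le_mul (c := C) hg (hp.aestronglyMeasurable.mul hg.1) ?_
  filter_upwards [ae_restrict_mem measurableSet_Icc] with ξ hξ
  rw [norm_mul]
  exact mul_le_mul_of_nonneg_right (hC ξ hξ) (norm_nonneg _)

lemma memLp_bandLegendre (n : ℕ) : MemLp (bandLegendre n) 2 band := by
  simpa using memLp_continuous_mul_band (memLp_const 1) (continuous_bandLegendre n)

lemma integral_bandLegendre_mul (n m : ℕ) :
    ∫ ξ, bandLegendre m ξ * bandLegendre n ξ ∂band = if n = m then 1 else 0 := by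
  have h : ∫ x in (-1 : ℝ)..1, (legendre n).eval x * (legendre m).eval x =
      if n = m then 2 / (2 * (n : ℝ) + 1) else 0 := by
    rcases lt_trichotomy n m with h | rfl | h
    · rw [if_neg h.ne]
      simp only [mul_comm ((legendre n).eval _)]
      exact integral_legendre_mul_legendre_of_lt h
    · rw [if_pos rfl, integral_legendre_sq]
    · rw [if_neg h.ne', integral_legendre_mul_legendre_of_lt h]
  have h2 := intervalIntegral.integral_comp_mul_left (a := -1 / 2) (b := 1 / 2)
    (fun x : ℝ => (legendre n).eval x * (legendre m).eval x) (c := -2) (by norm_num)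
  rw [show (-2 : ℝ) * (-1 / 2) = 1 by norm_num, show (-2 : ℝ) * (1 / 2) = -1 by norm_num,
    intervalIntegral.integral_symm (-1 : ℝ) 1, h] at h2
  have e : ∀ ξ, bandLegendre m ξ * bandLegendre n ξ =
      ((√(2 * n + 1) * √(2 * m + 1) * ((legendre n).eval (-2 * ξ) * (legendre m).eval (-2 * ξ)) :
        ℝ) : ℂ) := fun ξ => by
    simp only [bandLegendre, orthoLegendre_eval_band]
    push_cast; ring
  simp only [e, integral_band]
  rw [intervalIntegral.integral_ofReal, intervalIntegral.integral_const_mul, h2]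
  split_ifs with hnm
  · subst hnm
    rw [Real.mul_self_sqrt (by positivity)]
    have : (2 * (n : ℂ) + 1) ≠ 0 := by exact_mod_cast (show 2 * n + 1 ≠ 0 by omega)
    simp
    field_simp
  · simp

lemma inner_bandLegendre (n : ℕ) {g : ℝ → ℂ} (hg : MemLp g 2 band) :
    inner ℂ ((memLp_bandLegendre n).toLp _) (hg.toLp g) = ∫ ξ, bandLegendre n ξ * g ξ ∂band := by
  rw [L2.inner_def]
  refine integral_congr_ae ?_
  filter_upwards [(memLp_bandLegendre n).coeFn_toLp, hg.coeFn_toLp] with ξ h1 h2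
  rw [h1, h2, RCLike.inner_apply, bandLegendre, Complex.conj_ofReal, mul_comm]

lemma orthonormal_bandLegendre :
    Orthonormal ℂ fun n => ((memLp_bandLegendre n).toLp _ : Lp ℂ 2 band) := by
  rw [orthonormal_iff_ite]
  intro n m
  rw [inner_bandLegendre, integral_bandLegendre_mul]
  simp only [eq_comm]

/-- By Bessel's inequality the expansion of a square integrable function in an orthonormal family
converges. -/
lemma summable_inner_smul_of_orthonormal {E : Type*} [NormedAddCommGroup E]
    [InnerProductSpace ℂ E] [CompleteSpace E] {v : ℕ → E} (hv : Orthonormal ℂ v) (x : E) :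
    Summable fun n => inner ℂ (v n) x • v n := by
  have := (hv.orthogonalFamily.summable_iff_norm_sq_summable fun n => inner ℂ (v n) x).mpr
    (hv.inner_products_summable x)
  simpa using this

/-! ### Convergence in the space of band limited functions -/

/-- The exponential `ξ ↦ e^{2πiξu}`. -/
noncomputable def modulation (u : ℂ) (ξ : ℝ) : ℂ :=
  Complex.exp (2 * Real.pi * Complex.I * ξ * u)

lemma continuous_modulation (u : ℂ) : Continuous (modulation u) := by
  unfold modulation; fun_prop

/-- The partial sums of the chromatic expansion correspond, on the band and after modulation by `u`,
to the partial sums of the Legendre expansion. -/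
lemma chromaticApprox_bandTransform {g : ℝ → ℂ} (hg : MemLp g 2 band) (u z : ℂ) (N : ℕ) :
    chromaticApprox (bandTransform g) u N z = bandTransform (fun ξ => modulation (-u) ξ *
      ∑ n ∈ range N, inner ℂ ((memLp_bandLegendre n).toLp _)
        ((memLp_continuous_mul_band hg (continuous_modulation u)).toLp _) * bandLegendre n ξ) z := by
  have hint : ∀ n, Integrable (fun ξ : ℝ => Complex.exp (2 * Real.pi * Complex.I * ξ * (z - u)) *
      bandLegendre n ξ) band := fun n =>
    integrable_continuous_mul_band ((memLp_bandLegendre n).integrable (by norm_num)) (by fun_prop)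
  have h1 : ∀ n, chromaticDeriv n (bandTransform g) u * (√(2 * n + 1) *
      sphericalBessel n (Real.pi * (z - u))) = ∫ ξ, inner ℂ ((memLp_bandLegendre n).toLp _)
        ((memLp_continuous_mul_band hg (continuous_modulation u)).toLp _) *
        (Complex.exp (2 * Real.pi * Complex.I * ξ * (z - u)) * bandLegendre n ξ) ∂band := fun n => by
    rw [integral_const_mul, chromaticDeriv_bandTransform (hg.integrable (by norm_num)),
      inner_bandLegendre]
    have h2 := bandTransform_orthoLegendre n (z - u)
    rw [bandTransform] at h2
    simp only [bandLegendre]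
    rw [h2, bandTransform, mul_comm ((-Complex.I) ^ n), mul_assoc]
    congr 1
    refine integral_congr_ae (Eventually.of_forall fun ξ => ?_)
    simp only [modulation]
    ring
  rw [chromaticApprox, sum_congr rfl fun n _ => h1 n, bandTransform,
    ← integral_finsetSum _ fun n _ => (hint n).const_mul _]
  refine integral_congr_ae (Eventually.of_forall fun ξ => ?_)
  simp only [mul_sum, modulation]
  refine sum_congr rfl fun n _ => ?_
  rw [show 2 * Real.pi * Complex.I * ξ * (z - u) = 2 * Real.pi * Complex.I * ξ * z +
    2 * Real.pi * Complex.I * ξ * -u by ring, Complex.exp_add]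
  ring

lemma eLpNorm_modulation_mul_le (u : ℂ) (h : ℝ → ℂ) :
    eLpNorm (fun ξ => modulation u ξ * h ξ) 2 band ≤
      ENNReal.ofReal (Real.exp (Real.pi * ‖u‖)) * eLpNorm h 2 band := by
  refine eLpNorm_le_mul_eLpNorm_of_ae_le_mul ?_ 2
  filter_upwards [ae_band_abs_le] with ξ hξ
  rw [norm_mul]
  exact mul_le_mul_of_nonneg_right (norm_exp_band_le hξ u) (norm_nonneg _)

lemma bandTransform_sub {g h : ℝ → ℂ} (hg : MemLp g 2 band) (hh : MemLp h 2 band) (z : ℂ) :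
    bandTransform (fun ξ => g ξ - h ξ) z = bandTransform g z - bandTransform h z := by
  simp only [bandTransform, mul_sub]
  exact integral_sub
    (integrable_continuous_mul_band (hg.integrable (by norm_num)) (by fun_prop))
    (integrable_continuous_mul_band (hh.integrable (by norm_num)) (by fun_prop))

/-- For a band limited function the chromatic expansion converges uniformly and in `L²`. The
Legendre expansion on the band converges in `L²` by Bessel's inequality; the limit is identified by
the pointwise convergence of the chromatic expansion, so completeness of the Legendre polynomials
is not used. -/
theorem chromaticApprox_tendsto_of_mem_BL {f : ℂ → ℂ} (hf : Differentiable ℂ f)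
    (hBL : (fun t : ℝ => f t) ∈ BL) (u : ℂ) :
    TendstoUniformly (fun (N : ℕ) (t : ℝ) => chromaticApprox f u N t) (fun t : ℝ => f t) atTop ∧
    (∀ N : ℕ, (fun t : ℝ => chromaticApprox f u N t) ∈ BL) ∧
    Tendsto (fun N : ℕ => eLpNorm (fun t : ℝ => chromaticApprox f u N t - f t) 2 volume)
      atTop (𝓝 0) := by
  obtain ⟨g, hg, rfl⟩ := exists_eq_bandTransform hf hBL
  set v : ℕ → Lp ℂ 2 band := fun n => (memLp_bandLegendre n).toLp _
  set G : Lp ℂ 2 band := (memLp_continuous_mul_band hg (continuous_modulation u)).toLp _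
  have hsum := (summable_inner_smul_of_orthonormal orthonormal_bandLegendre G).hasSum
  set S : Lp ℂ 2 band := ∑' n, inner ℂ (v n) G • v n
  set s : ℕ → ℝ → ℂ := fun N ξ => ∑ n ∈ range N, inner ℂ (v n) G * bandLegendre n ξ
  have hs : ∀ N, MemLp (s N) 2 band := fun N =>
    memLp_finsetSum _ fun n _ => (memLp_bandLegendre n).const_mul _
  have hs_eq : ∀ N, (hs N).toLp _ = ∑ n ∈ range N, inner ℂ (v n) G • v n := fun N => by
    refine Lp.ext ((hs N).coeFn_toLp.trans ?_)
    have h1 := Lp.coeFn_finsetSum (range N) fun n => inner ℂ (v n) G • v n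
    have h2 : ∀ᵐ ξ ∂band, ∀ n, (inner ℂ (v n) G • v n : Lp ℂ 2 band) ξ =
        inner ℂ (v n) G * bandLegendre n ξ := by
      rw [ae_all_iff]
      intro n
      filter_upwards [Lp.coeFn_smul (inner ℂ (v n) G) (v n), (memLp_bandLegendre n).coeFn_toLp]
        with ξ h3 h4
      rw [h3, Pi.smul_apply, h4, smul_eq_mul]
    filter_upwards [h1, h2] with ξ h1 h2
    rw [h1, Finset.sum_apply]
    exact sum_congr rfl fun n _ => (h2 n).symm
  have hconv : Tendsto (fun N => eLpNorm (fun ξ => s N ξ - S ξ) 2 band) atTop (𝓝 0) := by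
    have h1 : Tendsto (fun N => (hs N).toLp (s N)) atTop (𝓝 S) := by
      simp only [hs_eq]
      exact hsum.tendsto_sum_nat
    rw [tendsto_iff_edist_tendsto_0] at h1
    refine h1.congr fun N => ?_
    rw [Lp.edist_def]
    refine eLpNorm_congr_ae ?_
    filter_upwards [(hs N).coeFn_toLp] with ξ hξ
    simp [hξ]
  have hm : MemLp (fun ξ => modulation (-u) ξ * S ξ) 2 band :=
    memLp_continuous_mul_band (Lp.memLp S) (continuous_modulation _)
  have hmN : ∀ N, MemLp (fun ξ => modulation (-u) ξ * s N ξ) 2 band := fun N =>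
    memLp_continuous_mul_band (hs N) (continuous_modulation _)
  set e : ℕ → ℝ → ℂ := fun N ξ => modulation (-u) ξ * s N ξ - modulation (-u) ξ * S ξ
  have he : ∀ N, MemLp (e N) 2 band := fun N => (hmN N).sub hm
  have happrox : ∀ N z, chromaticApprox (bandTransform g) u N z =
      bandTransform (fun ξ => modulation (-u) ξ * s N ξ) z :=
    fun N z => chromaticApprox_bandTransform hg u z N
  -- the error of the approximation is the transform of the error on the band
  have hdiff : ∀ N z, chromaticApprox (bandTransform g) u N z -
      bandTransform (fun ξ => modulation (-u) ξ * S ξ) z = bandTransform (e N) z := fun N z => by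
    rw [happrox, ← bandTransform_sub (hmN N) hm]
  have herr : Tendsto (fun N => eLpNorm (e N) 2 band) atTop (𝓝 0) := by
    have h1 := ENNReal.Tendsto.const_mul (a := ENNReal.ofReal (Real.exp (Real.pi * ‖-u‖))) hconv
      (Or.inr ENNReal.ofReal_ne_top)
    rw [mul_zero] at h1
    refine tendsto_of_tendsto_of_tendsto_of_le_of_le tendsto_const_nhds h1
      (fun _ => bot_le) fun N => ?_
    simp only [e, ← mul_sub]
    exact eLpNorm_modulation_mul_le (-u) _
  have herr' : Tendsto (fun N => (eLpNorm (e N) 2 band).toReal) atTop (𝓝 0) := by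
    exact (ENNReal.tendsto_toReal ENNReal.zero_ne_top).comp herr
  have hunif : TendstoUniformly
      (fun (N : ℕ) (t : ℝ) => chromaticApprox (bandTransform g) u N t)
      (fun t : ℝ => bandTransform (fun ξ => modulation (-u) ξ * S ξ) t) atTop := by
    rw [Metric.tendstoUniformly_iff]
    intro ε hε
    filter_upwards [herr'.eventually_lt_const hε] with N hN t
    rw [_root_.dist_comm, dist_eq_norm, hdiff]
    exact (norm_bandTransform_ofReal_le (he N) t).trans_lt hN
  have hlim : ∀ t : ℝ, bandTransform (fun ξ => modulation (-u) ξ * S ξ) t = bandTransform g t :=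
    fun t => tendsto_nhds_unique (hunif.tendsto_at t) (hasSum_chromatic hf t u).tendsto_sum_nat
  refine ⟨?_, fun N => ?_, ?_⟩
  · simpa only [hlim] using hunif
  · simpa only [happrox] using bandTransform_mem_BL (hmN N)
  · refine herr.congr fun N => ?_
    rw [← eLpNorm_bandTransform (he N)]
    simp only [← hdiff, hlim]

end Chromatic

theorem mainTheorem3 :
    -- the three forms of the chromatic expansion agree term by term
    (∀ (n : ℕ) (z u : ℂ),
      Chromatic.chromaticDeriv n (fun v => Chromatic.sinc (z - v)) u
          = (-1) ^ n * Chromatic.chromaticDeriv n Chromatic.sinc (z - u) ∧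
      (-1) ^ n * Chromatic.chromaticDeriv n Chromatic.sinc (z - u)
          = Real.sqrt (2 * n + 1) * Chromatic.sphericalBessel n (Real.pi * (z - u))) ∧
    ∀ f : ℂ → ℂ, Differentiable ℂ f →
      -- each of them converges to `f`, for all complex `z` and `u`
      (∀ z u : ℂ,
        HasSum (fun n : ℕ => Chromatic.chromaticDeriv n f u *
          Chromatic.chromaticDeriv n (fun v => Chromatic.sinc (z - v)) u) (f z) ∧
        HasSum (fun n : ℕ => (-1) ^ n * Chromatic.chromaticDeriv n f u *
          Chromatic.chromaticDeriv n Chromatic.sinc (z - u)) (f z) ∧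
        HasSum (fun n : ℕ => Chromatic.chromaticDeriv n f u *
          (Real.sqrt (2 * n + 1) *
            Chromatic.sphericalBessel n (Real.pi * (z - u)))) (f z)) ∧
      -- for band limited `f`, uniform convergence on `ℝ` and convergence in `BL(π)`
      ((fun t : ℝ => f t) ∈ Chromatic.BL → ∀ u : ℂ,
        TendstoUniformly (fun (N : ℕ) (t : ℝ) => Chromatic.chromaticApprox f u N t)
          (fun t : ℝ => f t) Filter.atTop ∧
        (∀ N : ℕ, (fun t : ℝ => Chromatic.chromaticApprox f u N t) ∈ Chromatic.BL) ∧
        Filter.Tendsto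
          (fun N : ℕ => MeasureTheory.eLpNorm
            (fun t : ℝ => Chromatic.chromaticApprox f u N t - f t) 2 MeasureTheory.volume)
          Filter.atTop (nhds 0)) := by
  have hterm : ∀ (n : ℕ) (z u : ℂ), (-1) ^ n * Chromatic.chromaticDeriv n Chromatic.sinc (z - u) =
      Real.sqrt (2 * n + 1) * Chromatic.sphericalBessel n (Real.pi * (z - u)) := fun n z u => by
    rw [Chromatic.chromaticDeriv_sinc, ← mul_assoc, ← mul_pow]
    simp
  refine ⟨fun n z u => ⟨?_, hterm n z u⟩, fun f hf => ⟨fun z u => ?_,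
    fun hBL u => Chromatic.chromaticApprox_tendsto_of_mem_BL hf hBL u⟩⟩
  · rw [hterm, Chromatic.chromaticDeriv_sinc_sub]
  · have h := Chromatic.hasSum_chromatic hf z u
    refine ⟨?_, ?_, h⟩
    · simpa only [Chromatic.chromaticDeriv_sinc_sub] using h
    · refine h.congr_fun fun n => ?_
      rw [← hterm]
      ring
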